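/- A $P$-group is a topological group whose underlying space is Tychonoff (completely regular and Hausdorff) and in which every $G_\delta$-subset is open. Let $\omega^*=\beta\omega\setminus\omega$ be the Čech–Stone remainder of the discrete space $\omega$, and let $\mathcal H(\omega^*)$ be its group of homeomorphisms with the compact-open topology, i.e. the topology with subbase the sets $\{f : f(K)\subseteq U\}$, $K\subseteq\omega^*$ compact, $U\subseteq\omega^*$ open. Let $\mathcal H(\omega^*)_{(\delta)}$ be its $G_\delta$-modification: the same group, with the topology having the $G_\delta$-subsets of $\mathcal H(\omega^*)$ as a base. Theorem 1.2. Assume the Continuum Hypothesis. Then $\mathcal H(\omega^*)_{(\delta)}$ is universal for the class of all $P$-groups of weight at most $\mathfrak c$. That is, $\mathcal H(\omega^*)_{(\delta)}$ is itself a $P$-group of weight at most $\mathfrak c$, and every $P$-group of weight at most $\mathfrak c$ is topologically isomorphic to a subgroup of $\mathcal H(\omega^*)_{(\delta)}$ (with the subspace topology). -/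

import Mathlib

open Topology

/-- The weight of a topological space: the least cardinality of a base for its topology. -/
noncomputable def weight (X : Type*) [TopologicalSpace X] : Cardinal :=
  sInf {κ | ∃ B : Set (Set X), TopologicalSpace.IsTopologicalBasis B ∧ Cardinal.mk B = κ}

/-- A `P`-group: a topological group which (as a space) is Tychonoff and a `P`-space, the latter
meaning that every `G_δ`-subset is open. -/
structure IsTopologicalPGroup (G : Type*) [Group G] [TopologicalSpace G] : Prop where
  isTopologicalGroup : IsTopologicalGroup G
  tychonoff : T35Space G
  isOpen_of_isGδ : ∀ s : Set G, IsGδ s → IsOpen s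

/-- The group `𝓗(X)` of all homeomorphisms of `X` onto itself, under composition. -/
def HomeoGroup (X : Type*) [TopologicalSpace X] : Type _ := X ≃ₜ X

instance HomeoGroup.instGroup (X : Type*) [TopologicalSpace X] : Group (HomeoGroup X) :=
  inferInstanceAs (Group (X ≃ₜ X))

/-- An element of `𝓗(X)`, viewed as a homeomorphism. -/
def HomeoGroup.toHomeomorph {X : Type*} [TopologicalSpace X] (f : HomeoGroup X) : X ≃ₜ X := f

/-- The compact-open topology on `𝓗(X)`, generated by the sets
`[K, U] = {f | f '' K ⊆ U}` with `K` compact and `U` open. -/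
instance HomeoGroup.instTopologicalSpace (X : Type*) [TopologicalSpace X] :
    TopologicalSpace (HomeoGroup X) :=
  TopologicalSpace.generateFrom
    {S | ∃ K U : Set X, IsCompact K ∧ IsOpen U ∧
      S = {f : HomeoGroup X | f.toHomeomorph '' K ⊆ U}}

/-- The `G_δ`-modification `X_(δ)` of a space `X`: the same underlying set, with the topology
generated by the `G_δ`-subsets of `X`. -/
def GDeltaModification (X : Type*) : Type _ := X

instance GDeltaModification.instGroup (G : Type*) [Group G] : Group (GDeltaModification G) :=
  inferInstanceAs (Group G)

instance GDeltaModification.instTopologicalSpace (X : Type*) [TopologicalSpace X] :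
    TopologicalSpace (GDeltaModification X) :=
  TopologicalSpace.generateFrom {s : Set X | IsGδ s}

/-- The `G_δ`-subsets of `X` form a base for the topology of `X_(δ)`. -/
theorem GDeltaModification.isTopologicalBasis (X : Type*) [TopologicalSpace X] :
    TopologicalSpace.IsTopologicalBasis (α := GDeltaModification X) {s : Set X | IsGδ s} where
  exists_subset_inter := fun s hs t ht _ hx => ⟨s ∩ t, IsGδ.inter hs ht, hx, subset_rfl⟩
  sUnion_eq := Set.eq_univ_of_forall fun _ => ⟨Set.univ, IsGδ.univ, trivial⟩
  eq_generateFrom := rfl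

/-- `ω* = βω \ ω`, the Čech–Stone remainder of the discrete space `ω`, as a subspace of `βω`. -/
abbrev OmegaStar : Type := {p : StoneCech ℕ // p ∉ Set.range (stoneCechUnit : ℕ → StoneCech ℕ)}

/-! In a `P`-group every neighbourhood of the identity contains an open subgroup. For a `P`-group
`G` of weight at most `𝔠`, choose such a subgroup inside each basic neighbourhood of the identity
and let `Y` be the disjoint union of the coset spaces. Then `Y` is a `G`-set of size at most `𝔠`
whose point stabilizers are open and arbitrarily small.

`G` acts on the algebra of finite and cofinite subsets of `Y`, and coordinatewise on its reduced
power modulo the Fréchet filter. The `P`-property keeps stabilizers open although an element of the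
power has countably many coordinates. Singletons, as constant sequences, give back the point
stabilizers.

Such reduced powers are countably saturated (`Filter.Germ.countablySaturated`), so under CH
back-and-forth makes this one isomorphic to the power set of `ω` modulo finite sets
(`CountablySaturated.nonempty_orderIso`), which is the clopen algebra of `ω*`. Stone duality turns
the action into a homomorphism to `𝓗(ω*)`. It is an embedding into `𝓗(ω*)_(δ)` because basic
neighbourhoods of a homeomorphism there are given by its values on countably many clopen sets
(`isOpen_iff_exists_agreeing`). -/

/-! ### Countable saturation of reduced powers. -/

open Filter in
instance Filter.Germ.instBooleanAlgebra {α β : Type*} {l : Filter α} [BooleanAlgebra β] :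
    BooleanAlgebra (Germ l β) where
  __ := Filter.Germ.instDistribLattice
  __ := Filter.Germ.instBoundedOrder
  compl := Germ.map compl
  inf_compl_le_bot x := by
    induction x using Germ.inductionOn with
    | h f => exact Germ.coe_le.2 (Eventually.of_forall fun k => inf_compl_self (f k) |>.le)
  top_le_sup_compl x := by
    induction x using Germ.inductionOn with
    | h f => exact Germ.coe_le.2 (Eventually.of_forall fun k => sup_compl_eq_top (x := f k) |>.ge)

/-- Countable saturation of a Boolean algebra with respect to types in one variable: given two
orthogonal increasing sequences `l` and `d` and a sequence `p`, some `c` lies above `l`, is disjoint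
from `d`, and is in general position with respect to each `p j` as far as `l` and `d` permit. -/
def CountablySaturated (C : Type*) [BooleanAlgebra C] : Prop :=
  ∀ l d p : ℕ → C, Monotone l → Monotone d → (∀ i, Disjoint (l i) (d i)) →
    ∃ c, (∀ i, l i ≤ c) ∧ (∀ i, Disjoint (d i) c) ∧
      ∀ j, ((∀ i, ¬ p j ≤ l i) → ¬ p j ≤ c) ∧ ((∀ i, ¬ p j ≤ d i) → ¬ Disjoint (p j) c)

open Filter in
/-- The reduced power of a Boolean algebra modulo the Fréchet filter is countably saturated. -/
theorem Filter.Germ.countablySaturated (B : Type*) [BooleanAlgebra B] :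
    CountablySaturated (Germ (atTop : Filter ℕ) B) := by
  intro l d p hl hd hld
  have rep : ∀ u : ℕ → Germ (atTop : Filter ℕ) B, ∃ U : ℕ → ℕ → B, ∀ i, u i = ↑(U i) := fun u =>
    ⟨fun i => (Quotient.exists_rep (u i)).choose, fun i => (Quotient.exists_rep (u i)).choose_spec.symm⟩
  obtain ⟨L, hL⟩ := rep l
  obtain ⟨D, hD⟩ := rep d
  obtain ⟨P, hP⟩ := rep p
  have coherent : ∀ i, ∀ᶠ k in atTop, (∀ i' ≤ i, L i' k ≤ L i k ∧ D i' k ≤ D i k) ∧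
      L i k ≤ (D i k)ᶜ := by
    intro i
    refine Eventually.and ?_ ?_
    · refine ((Set.finite_Iic i).eventually_all (l := atTop)
        (p := fun i' k => L i' k ≤ L i k ∧ D i' k ≤ D i k)).2 fun i' hi' => Eventually.and ?_ ?_
      · have := hl hi'
        rw [hL, hL] at this
        exact Germ.coe_le.1 this
      · have := hd hi'
        rw [hD, hD] at this
        exact Germ.coe_le.1 this
    · have := (hld i).le_compl_right
      rw [hL, hD] at this
      exact Germ.coe_le.1 this
  have later : ∀ (u U : ℕ → B) (_ : ¬ (u : Germ (atTop : Filter ℕ) B) ≤ U) (a : ℕ),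
      ∀ᶠ b in atTop, ∃ k, a ≤ k ∧ k < b ∧ ¬ u k ≤ U k := by
    intro u U h a
    rw [Germ.coe_le, EventuallyLE, not_eventually] at h
    obtain ⟨k, hk, hk'⟩ := (h.forall_exists_of_atTop) a
    filter_upwards [eventually_gt_atTop k] with b hb using ⟨k, hk, hb, hk'⟩
  -- The next block endpoint `b` is so large that level `i + 1` is coherent from `b` on, and that
  -- the block `[a, b)` contains level-`i` witnesses for the first `i + 1` requirements.
  have step : ∀ i a, ∃ b, a < b ∧ (∀ k ≥ b, (∀ i' ≤ i + 1, L i' k ≤ L (i + 1) k ∧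
      D i' k ≤ D (i + 1) k) ∧ L (i + 1) k ≤ (D (i + 1) k)ᶜ) ∧
      ∀ j ≤ i, ((∀ i, ¬ p j ≤ l i) → ∃ k, a ≤ k ∧ k < b ∧ ¬ P j k ≤ L i k) ∧
        ((∀ i, ¬ p j ≤ d i) → ∃ k, a ≤ k ∧ k < b ∧ ¬ P j k ≤ D i k) := by
    intro i a
    refine Eventually.exists (f := atTop) ?_
    refine (eventually_gt_atTop a).and (Eventually.and ?_ ?_)
    · obtain ⟨N, hN⟩ := eventually_atTop.1 (coherent (i + 1))
      filter_upwards [eventually_ge_atTop N] with b hb k hk using hN k (hb.trans hk)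
    · refine ((Set.finite_Iic i).eventually_all (l := atTop)).2 fun j _ => Eventually.and ?_ ?_
      · by_cases h : ∀ i, ¬ p j ≤ l i
        · have h' := h i
          rw [hP, hL] at h'
          filter_upwards [later _ _ h' a] with b hb _ using hb
        · exact Eventually.of_forall fun _ h' => (h h').elim
      · by_cases h : ∀ i, ¬ p j ≤ d i
        · have h' := h i
          rw [hP, hD] at h'
          filter_upwards [later _ _ h' a] with b hb _ using hb
        · exact Eventually.of_forall fun _ h' => (h h').elim
  choose next next_gt next_coherent next_witness using step
  obtain ⟨K₀, hK₀⟩ := eventually_atTop.1 (coherent 0)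
  let K : ℕ → ℕ := fun i => Nat.rec (motive := fun _ => ℕ) K₀ next i
  have K_succ : ∀ i, K (i + 1) = next i (K i) := fun _ => rfl
  have K_mono : StrictMono K := strictMono_nat_of_lt_succ fun i => next_gt i (K i)
  have K_coherent : ∀ i, ∀ k ≥ K i, (∀ i' ≤ i, L i' k ≤ L i k ∧ D i' k ≤ D i k) ∧
      L i k ≤ (D i k)ᶜ := by
    rintro (_ | i) k hk
    · exact hK₀ k hk
    · exact next_coherent i (K i) k hk
  -- The index of the block containing `k`. The search bound `k` is harmless since `i ≤ K i`; values
  -- before `K 0` do not affect the germ.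
  let s : ℕ → ℕ := fun k => Nat.findGreatest (fun i : ℕ => K i ≤ k) k
  have le_s : ∀ i k, K i ≤ k → i ≤ s k := fun i k h =>
    Nat.le_findGreatest (P := fun i => K i ≤ k) ((K_mono.le_apply (x := i)).trans h) h
  have K_s : ∀ i k, K i ≤ k → K (s k) ≤ k := fun i k h =>
    Nat.findGreatest_spec (P := fun i => K i ≤ k) ((K_mono.le_apply (x := i)).trans h) h
  have s_eq : ∀ i k, K i ≤ k → k < K (i + 1) → s k = i := fun i k h h' =>
    le_antisymm (Nat.lt_succ_iff.1 (K_mono.lt_iff_lt.1 ((K_s i k h).trans_lt h'))) (le_s i k h)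
  -- The smallest permitted value on even blocks and the largest on odd ones: even blocks defeat `p
  -- j ≤ c`, odd blocks defeat disjointness of `p j` from `c`.
  let c : ℕ → B := fun k => if Even (s k) then L (s k) k else (D (s k) k)ᶜ
  refine ⟨(c : Germ (atTop : Filter ℕ) B), fun i => ?_, fun i => ?_, fun j => ⟨fun h hc => ?_,
    fun h hc => ?_⟩⟩
  · rw [hL]
    refine Germ.coe_le.2 (eventually_atTop.2 ⟨K i, fun k hk => ?_⟩)
    have hE := K_coherent (s k) k (K_s i k hk)
    have h1 := (hE.1 i (le_s i k hk)).1
    simp only [c]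
    split_ifs
    · exact h1
    · exact h1.trans hE.2
  · rw [hD, ← le_compl_iff_disjoint_right]
    refine Germ.coe_le.2 (eventually_atTop.2 ⟨K i, fun k hk => ?_⟩)
    have hE := K_coherent (s k) k (K_s i k hk)
    have h1 := (hE.1 i (le_s i k hk)).2
    simp only [Function.comp, c]
    split_ifs
    · exact h1.trans (le_compl_comm.1 hE.2)
    · simpa using h1
  · rw [hP] at hc
    obtain ⟨N, hN⟩ := eventually_atTop.1 (Germ.coe_le.1 hc)
    -- The block number is even, at least `j` so that requirement `j` is treated there, and at least
    -- `N` so that the block lies beyond `N`.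
    obtain ⟨k, hk, hk', hk''⟩ := (next_witness (2 * (j + N)) (K (2 * (j + N))) j (by omega)).1 h
    refine hk'' ?_
    have := hN k (le_trans (le_trans (by omega) (K_mono.le_apply (x := 2 * (j + N)))) hk)
    simpa [c, s_eq _ _ hk hk'] using this
  · rw [hP, ← le_compl_iff_disjoint_right] at hc
    obtain ⟨N, hN⟩ := eventually_atTop.1 (Germ.coe_le.1 hc)
    obtain ⟨k, hk, hk', hk''⟩ :=
      (next_witness (2 * (j + N) + 1) (K (2 * (j + N) + 1)) j (by omega)).2 h
    refine hk'' ?_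
    have := hN k (le_trans (le_trans (by omega) (K_mono.le_apply (x := 2 * (j + N) + 1))) hk)
    simpa [c, s_eq _ _ hk hk'] using this

/-! ### Back-and-forth between countably saturated algebras. -/

/-- If every countable chain of `P` is bounded above, then a family of cofinal sets
indexed by a well-order with countable initial segments is met by a monotone family. -/
theorem exists_monotone_forall_mem {I P : Type*} [LinearOrder I] [WellFoundedLT I] [Preorder P]
    (hI : ∀ i : I, (Set.Iio i).Countable)
    (hP : ∀ S : Set P, S.Countable → IsChain (· ≤ ·) S → BddAbove S)
    (D : I → Set P) (hD : ∀ i p, ∃ q ∈ D i, p ≤ q) :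
    ∃ f : I → P, Monotone f ∧ ∀ i, f i ∈ D i := by
  classical
  obtain ⟨p₀, -⟩ := hP ∅ Set.countable_empty (by simp)
  choose e heD hle using hD
  -- The default `p₀` is never reached: the earlier values always form a countable chain.
  let ub : Set P → P := fun S => if h : BddAbove S then h.some else p₀
  have hub : ∀ S, BddAbove S → ∀ p ∈ S, p ≤ ub S := fun S h p hp => by
    simpa only [ub, dif_pos h] using h.some_mem hp
  let f : I → P := (wellFounded_lt (α := I)).fix fun i ih =>
    e i (ub (Set.range fun j : Set.Iio i => ih j.1 j.2))
  have f_eq : ∀ i, f i = e i (ub (f '' Set.Iio i)) := fun i => by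
    rw [Set.image_eq_range]
    exact (wellFounded_lt (α := I)).fix_eq _ i
  have key : ∀ i, ∀ j < i, f j ≤ f i := by
    intro i
    induction i using (wellFounded_lt (α := I)).induction with
    | _ i ih =>
      intro j hj
      have chain : IsChain (· ≤ ·) (f '' Set.Iio i) := by
        rintro _ ⟨a, ha, rfl⟩ _ ⟨b, hb, rfl⟩ -
        rcases lt_trichotomy a b with h | h | h
        · exact Or.inl (ih b hb a h)
        · exact Or.inl (by rw [h])
        · exact Or.inr (ih a ha b h)
      rw [f_eq i]
      exact (hub _ (hP _ ((hI i).image f) chain) _ ⟨j, hj, rfl⟩).trans (hle _ _)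
  refine ⟨f, fun j i h => ?_, fun i => f_eq i ▸ heD _ _⟩
  rcases h.lt_or_eq with h | rfl
  · exact key i j h
  · exact le_rfl

/-- Since `a ≤ b` means `a \ b = ⊥`, the kernel determines the induced order. -/
theorem map_le_map_iff_of_map_eq_bot_iff {R C C' : Type*} [BooleanAlgebra R] [BooleanAlgebra C]
    [BooleanAlgebra C'] (φ : BoundedLatticeHom R C) (ψ : BoundedLatticeHom R C')
    (h : ∀ r, φ r = ⊥ ↔ ψ r = ⊥) (r s : R) : φ r ≤ φ s ↔ ψ r ≤ ψ s := by
  rw [← sdiff_eq_bot_iff, ← map_sdiff', h, map_sdiff', sdiff_eq_bot_iff]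

/-- One step of the back-and-forth construction. -/
theorem CountablySaturated.exists_corresponding {R C C' : Type*} [BooleanAlgebra R]
    [BooleanAlgebra C] [BooleanAlgebra C'] [Countable R] (hC' : CountablySaturated C')
    (φ : BoundedLatticeHom R C) (ψ : BoundedLatticeHom R C') (h : ∀ r, φ r = ⊥ ↔ ψ r = ⊥) (c : C) :
    ∃ c', ∀ r, (φ r ≤ c ↔ ψ r ≤ c') ∧ (Disjoint (φ r) c ↔ Disjoint (ψ r) c') := by
  classical
  have hle := map_le_map_iff_of_map_eq_bot_iff φ ψ h
  obtain ⟨e, he⟩ := exists_surjective_nat R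
  have approx : ∀ c : C, ∃ l : ℕ → R, Monotone l ∧ (∀ i, φ (l i) ≤ c) ∧
      ∀ r, φ r ≤ c → ∃ i, r ≤ l i := by
    -- Elements sent below `c` form a countable ideal, so partial joins of an enumeration give an
    -- increasing cofinal sequence. Applied to `c` and `cᶜ`, this describes the type of `c` over `R`
    -- in the form saturation can realize.
    intro c
    refine ⟨partialSups fun n => if φ (e n) ≤ c then e n else ⊥, (partialSups _).monotone,
      fun i => ?_, fun r hr => ?_⟩
    · induction i with
      | zero =>
        rw [partialSups_zero]
        split_ifs with h
        · exact h
        · simp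
      | succ i ih =>
        rw [partialSups_add_one, map_sup]
        refine sup_le ih ?_
        split_ifs with h
        · exact h
        · simp
    · obtain ⟨n, rfl⟩ := he r
      refine ⟨n, le_trans ?_ (le_partialSups _ n)⟩
      rw [if_pos hr]
  obtain ⟨l, l_mono, l_le, l_max⟩ := approx c
  obtain ⟨d, d_mono, d_le, d_max⟩ := approx cᶜ
  obtain ⟨c', hl, hd, hp⟩ := hC' (ψ ∘ l) (ψ ∘ d) (ψ ∘ e)
    ((OrderHomClass.mono ψ).comp l_mono) ((OrderHomClass.mono ψ).comp d_mono) fun i => by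
      rw [disjoint_iff, Function.comp, Function.comp, ← map_inf, ← h, map_inf, ← disjoint_iff]
      exact (disjoint_compl_right.mono_right (d_le i)).mono_left (l_le i)
  refine ⟨c', fun r => ?_⟩
  obtain ⟨j, rfl⟩ := he r
  refine ⟨⟨fun hr => ?_, fun hr => ?_⟩, ⟨fun hr => ?_, fun hr => ?_⟩⟩
  · obtain ⟨i, hi⟩ := l_max _ hr
    exact (OrderHomClass.mono ψ hi).trans (hl i)
  · by_contra hc
    exact (hp j).1 (fun i hi => hc (((hle _ _).2 hi).trans (l_le i))) hr
  · obtain ⟨i, hi⟩ := d_max _ hr.le_compl_right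
    exact (hd i).mono_left (OrderHomClass.mono ψ hi)
  · by_contra hc
    exact (hp j).2 (fun i hi =>
      hc (le_compl_iff_disjoint_right.1 (((hle _ _).2 hi).trans (d_le i)))) hr

theorem eq_of_inf_eq_of_inf_compl_eq {C : Type*} [BooleanAlgebra C] {x y q : C}
    (h : x ⊓ q = y ⊓ q) (h' : x ⊓ qᶜ = y ⊓ qᶜ) : x = y := by
  rw [← inf_top_eq x, ← inf_top_eq y, ← sup_compl_eq_top (x := q), inf_sup_left, inf_sup_left, h, h']

theorem inf_sup_inf_compl_inf_self {C : Type*} [BooleanAlgebra C] (a b q : C) :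
    (a ⊓ q ⊔ b ⊓ qᶜ) ⊓ q = a ⊓ q := by
  simp [inf_sup_right, inf_assoc]

theorem inf_sup_inf_compl_inf_compl {C : Type*} [BooleanAlgebra C] (a b q : C) :
    (a ⊓ q ⊔ b ⊓ qᶜ) ⊓ qᶜ = b ⊓ qᶜ := by
  simp [inf_sup_right, inf_assoc]

theorem compl_inf_eq_of_inf_eq {C : Type*} [BooleanAlgebra C] {x a q : C} (h : x ⊓ q = a ⊓ q) :
    xᶜ ⊓ q = aᶜ ⊓ q := by
  have (z : C) : zᶜ ⊓ q = (z ⊓ q)ᶜ ⊓ q := by simp [compl_inf, inf_sup_right]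
  rw [this, h, ← this]

/-- The subalgebra generated by a subalgebra and one further element. -/
def BooleanSubalgebra.adjoin {C : Type*} [BooleanAlgebra C] (R : BooleanSubalgebra C) (q : C) :
    BooleanSubalgebra C where
  carrier := Set.range fun x : R × R => x.1.1 ⊓ q ⊔ x.2.1 ⊓ qᶜ
  supClosed' := by
    rintro _ ⟨x, rfl⟩ _ ⟨y, rfl⟩
    refine ⟨x ⊔ y, ?_⟩
    simp only [Prod.fst_sup, Prod.snd_sup, val_sup, inf_sup_right]
    ac_rfl
  infClosed' := by
    rintro _ ⟨x, rfl⟩ _ ⟨y, rfl⟩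
    refine ⟨x ⊓ y, eq_of_inf_eq_of_inf_compl_eq (q := q) ?_ ?_⟩
    · dsimp only
      rw [inf_assoc _ _ q, inf_sup_inf_compl_inf_self, inf_sup_inf_compl_inf_self, ← inf_assoc,
        inf_right_comm, inf_sup_inf_compl_inf_self, inf_right_comm]
      rfl
    · dsimp only
      rw [inf_assoc _ _ qᶜ, inf_sup_inf_compl_inf_compl, inf_sup_inf_compl_inf_compl, ← inf_assoc,
        inf_right_comm, inf_sup_inf_compl_inf_compl, inf_right_comm]
      rfl
  compl_mem' := by
    rintro _ ⟨x, rfl⟩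
    refine ⟨(x.1ᶜ, x.2ᶜ), eq_of_inf_eq_of_inf_compl_eq (q := q) ?_ ?_⟩
    · rw [inf_sup_inf_compl_inf_self,
        compl_inf_eq_of_inf_eq (inf_sup_inf_compl_inf_self x.1.1 x.2.1 q)]
      rfl
    · rw [inf_sup_inf_compl_inf_compl,
        compl_inf_eq_of_inf_eq (inf_sup_inf_compl_inf_compl x.1.1 x.2.1 q)]
      rfl
  bot_mem' := ⟨(⊥, ⊥), by simp⟩

/-- The condition that a subalgebra of `C × C'` be the graph of an isomorphism between
subalgebras of `C` and `C'`. -/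
def BooleanSubalgebra.IsPartialIso {C C' : Type*} [BooleanAlgebra C] [BooleanAlgebra C']
    (R : BooleanSubalgebra (C × C')) : Prop :=
  ∀ r ∈ R, r.1 = ⊥ ↔ r.2 = ⊥

namespace BooleanSubalgebra

variable {C C' : Type*} [BooleanAlgebra C] [BooleanAlgebra C']

theorem le_adjoin (R : BooleanSubalgebra C) (q : C) : R ≤ R.adjoin q := fun r hr =>
  ⟨(⟨r, hr⟩, ⟨r, hr⟩), by simp [← inf_sup_left]⟩

theorem mem_adjoin_self (R : BooleanSubalgebra C) (q : C) : q ∈ R.adjoin q :=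
  ⟨(⊤, ⊥), by simp⟩

theorem countable_adjoin {R : BooleanSubalgebra C} (hR : (R : Set C).Countable) (q : C) :
    (R.adjoin q : Set C).Countable := by
  have : Countable R := hR.to_subtype
  exact Set.countable_range _

/-- The first projection of a subalgebra of a product. -/
def fstHom (R : BooleanSubalgebra (C × C')) : BoundedLatticeHom R C where
  toFun r := r.1.1
  map_sup' _ _ := rfl
  map_inf' _ _ := rfl
  map_top' := rfl
  map_bot' := rfl

/-- The second projection of a subalgebra of a product. -/
def sndHom (R : BooleanSubalgebra (C × C')) : BoundedLatticeHom R C' where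
  toFun r := r.1.2
  map_sup' _ _ := rfl
  map_inf' _ _ := rfl
  map_top' := rfl
  map_bot' := rfl

theorem IsPartialIso.le_iff {R : BooleanSubalgebra (C × C')} (hR : R.IsPartialIso)
    {r s : C × C'} (hr : r ∈ R) (hs : s ∈ R) : r.1 ≤ s.1 ↔ r.2 ≤ s.2 :=
  map_le_map_iff_of_map_eq_bot_iff R.fstHom R.sndHom (fun r => hR r.1 r.2) ⟨r, hr⟩ ⟨s, hs⟩

/-- `r ⊓ q ⊔ s ⊓ qᶜ` vanishes exactly when `r` is disjoint from `q` and `s ≤ q`, so the two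
equivalences in `hq` suffice. -/
theorem IsPartialIso.adjoin {R : BooleanSubalgebra (C × C')} {q : C × C'}
    (hq : ∀ r ∈ R, (r.1 ≤ q.1 ↔ r.2 ≤ q.2) ∧ (Disjoint r.1 q.1 ↔ Disjoint r.2 q.2)) :
    (R.adjoin q).IsPartialIso := by
  rintro _ ⟨⟨r, s⟩, rfl⟩
  have h1 := (hq r.1 r.2).2
  have h2 := (hq s.1 s.2).1
  rw [disjoint_iff, disjoint_iff] at h1
  rw [← disjoint_compl_right_iff, ← disjoint_compl_right_iff, disjoint_iff, disjoint_iff] at h2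
  change r.1.1 ⊓ q.1 ⊔ s.1.1 ⊓ q.1ᶜ = ⊥ ↔ r.1.2 ⊓ q.2 ⊔ s.1.2 ⊓ q.2ᶜ = ⊥
  rw [sup_eq_bot_iff, sup_eq_bot_iff, h1, h2]

/-- The countable partial isomorphisms between two Boolean algebras, ordered by extension. -/
abbrev CountablePartialIso (C C' : Type*) [BooleanAlgebra C] [BooleanAlgebra C'] : Type _ :=
  {R : BooleanSubalgebra (C × C') // (R : Set (C × C')).Countable ∧ R.IsPartialIso}

theorem CountablePartialIso.exists_le_mem_left (hC' : CountablySaturated C')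
    (R : CountablePartialIso C C') (c : C) : ∃ S, R ≤ S ∧ ∃ c', (c, c') ∈ S.1 := by
  obtain ⟨R, hc, hR⟩ := R
  have : Countable R := hc.to_subtype
  obtain ⟨c', h⟩ := hC'.exists_corresponding R.fstHom R.sndHom (fun r => hR r.1 r.2) c
  exact ⟨⟨R.adjoin (c, c'), countable_adjoin hc _, IsPartialIso.adjoin fun r hr => h ⟨r, hr⟩⟩,
    le_adjoin _ _, c', mem_adjoin_self _ _⟩

theorem CountablePartialIso.exists_le_mem_right (hC : CountablySaturated C)
    (R : CountablePartialIso C C') (c' : C') : ∃ S, R ≤ S ∧ ∃ c, (c, c') ∈ S.1 := by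
  obtain ⟨R, hc, hR⟩ := R
  have : Countable R := hc.to_subtype
  obtain ⟨c, h⟩ := hC.exists_corresponding R.sndHom R.fstHom (fun r => (hR r.1 r.2).symm) c'
  exact ⟨⟨R.adjoin (c, c'), countable_adjoin hc _,
    IsPartialIso.adjoin fun r hr => ⟨(h ⟨r, hr⟩).1.symm, (h ⟨r, hr⟩).2.symm⟩⟩,
    le_adjoin _ _, c, mem_adjoin_self _ _⟩

theorem CountablePartialIso.bddAbove [Nontrivial C] [Nontrivial C']
    (S : Set (CountablePartialIso C C')) (hS : S.Countable) (hc : IsChain (· ≤ ·) S) :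
    BddAbove S := by
  rcases S.eq_empty_or_nonempty with rfl | ⟨R₀, hR₀⟩
  -- The empty chain is bounded by the two-element subalgebra; nontriviality of both algebras makes
  -- it a partial isomorphism.
  · refine ⟨⟨⊥, ?_, ?_⟩, by simp [upperBounds]⟩
    · rw [coe_bot]
      exact (Set.toFinite _).countable
    · rintro r (rfl | rfl) <;> simp
  · have dir : ∀ R ∈ S, ∀ T ∈ S, ∃ U ∈ S, R ≤ U ∧ T ≤ U := fun R hR T hT =>
      hc.directedOn R hR T hT
    have carrier_dir : ∀ a ∈ ⋃ R ∈ S, (R.1 : Set (C × C')), ∀ b ∈ ⋃ R ∈ S, (R.1 : Set (C × C')),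
        ∃ U ∈ S, a ∈ U.1 ∧ b ∈ U.1 := by
      intro a ha b hb
      obtain ⟨R, hR, ha⟩ := Set.mem_iUnion₂.1 ha
      obtain ⟨T, hT, hb⟩ := Set.mem_iUnion₂.1 hb
      obtain ⟨U, hU, hRU, hTU⟩ := dir R hR T hT
      exact ⟨U, hU, hRU ha, hTU hb⟩
    let V : BooleanSubalgebra (C × C') :=
      { carrier := ⋃ R ∈ S, (R.1 : Set (C × C'))
        supClosed' := fun a ha b hb => by
          obtain ⟨U, hU, ha, hb⟩ := carrier_dir a ha b hb
          exact Set.mem_iUnion₂.2 ⟨U, hU, sup_mem ha hb⟩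
        infClosed' := fun a ha b hb => by
          obtain ⟨U, hU, ha, hb⟩ := carrier_dir a ha b hb
          exact Set.mem_iUnion₂.2 ⟨U, hU, inf_mem ha hb⟩
        compl_mem' := fun {a} ha => by
          obtain ⟨R, hR, ha⟩ := Set.mem_iUnion₂.1 ha
          exact Set.mem_iUnion₂.2 ⟨R, hR, compl_mem ha⟩
        bot_mem' := Set.mem_iUnion₂.2 ⟨R₀, hR₀, bot_mem⟩ }
    refine ⟨⟨V, hS.biUnion fun R _ => R.2.1, fun r hr => ?_⟩, fun R hR r hr =>
      Set.mem_iUnion₂.2 ⟨R, hR, hr⟩⟩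
    obtain ⟨R, hR, hr⟩ := Set.mem_iUnion₂.1 hr
    exact R.2.2 r hr

end BooleanSubalgebra

theorem Cardinal.exists_surjective_of_mk_eq_continuum {I E : Type*} [Nonempty E]
    (hI : Cardinal.mk I = Cardinal.continuum) (hE : Cardinal.mk E ≤ Cardinal.continuum) :
    ∃ e : I → E, Function.Surjective e := by
  obtain ⟨j⟩ := Cardinal.lift_mk_le'.1
    (show Cardinal.lift (Cardinal.mk E) ≤ Cardinal.lift (Cardinal.mk I) by simpa [hI] using hE)
  exact ⟨Function.invFun j, Function.invFun_surjective j.injective⟩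

open BooleanSubalgebra in
/-- Under the Continuum Hypothesis, any two nontrivial countably saturated Boolean algebras of
cardinality at most `𝔠` are isomorphic. -/
theorem CountablySaturated.nonempty_orderIso
    (CH : Cardinal.aleph 1 = (Cardinal.continuum : Cardinal.{0})) {C : Type*} {C' : Type*}
    [BooleanAlgebra C] [BooleanAlgebra C'] [Nontrivial C] [Nontrivial C']
    (hC : CountablySaturated C) (hC' : CountablySaturated C')
    (cC : Cardinal.mk C ≤ Cardinal.continuum) (cC' : Cardinal.mk C' ≤ Cardinal.continuum) :
    Nonempty (C ≃o C') := by
  -- Initial segments of `ω₁` are countable, so stages stay countable; by CH, `ω₁` is long enough to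
  -- list both algebras.
  let I : Type := (Cardinal.aleph 1).ord.ToType
  have hI : ∀ i : I, (Set.Iio i).Countable := fun i => by
    rw [← Cardinal.le_aleph0_iff_set_countable, ← Cardinal.lt_aleph_one_iff]
    refine (Cardinal.mk_Iio_lt i (by simp [I])).trans_eq (by simp [I])
  have cI : Cardinal.mk I = Cardinal.continuum := by
    rw [← CH]
    simp [I]
  obtain ⟨e, he⟩ := Cardinal.exists_surjective_of_mk_eq_continuum cI cC
  obtain ⟨e', he'⟩ := Cardinal.exists_surjective_of_mk_eq_continuum cI cC'
  obtain ⟨f, f_mono, hf⟩ := exists_monotone_forall_mem hI CountablePartialIso.bddAbove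
    (fun i => {R : CountablePartialIso C C' |
      (∃ c', (e i, c') ∈ R.1) ∧ ∃ c, (c, e' i) ∈ R.1}) (fun i R => by
        obtain ⟨S, hRS, c', hc'⟩ := R.exists_le_mem_left hC' (e i)
        obtain ⟨T, hST, c, hc⟩ := S.exists_le_mem_right hC (e' i)
        exact ⟨T, ⟨⟨c', hST hc'⟩, c, hc⟩, hRS.trans hST⟩)
  have left : ∀ c, ∃ c', ∃ i, (c, c') ∈ (f i).1 := fun c => by
    obtain ⟨i, rfl⟩ := he c
    exact ⟨_, i, (hf i).1.choose_spec⟩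
  have right : ∀ c', ∃ c, ∃ i, (c, c') ∈ (f i).1 := fun c => by
    obtain ⟨i, rfl⟩ := he' c
    exact ⟨_, i, (hf i).2.choose_spec⟩
  have le_iff : ∀ a a' b b', (∃ i, (a, a') ∈ (f i).1) → (∃ i, (b, b') ∈ (f i).1) →
      (a ≤ b ↔ a' ≤ b') := by
    rintro a a' b b' ⟨i, hi⟩ ⟨j, hj⟩
    rcases le_total i j with h | h
    · exact (f j).2.2.le_iff (f_mono h hi) hj
    · exact (f i).2.2.le_iff hi (f_mono h hj)
  choose F hF using left
  choose G hG using right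
  let E : C ≃ C' :=
    ⟨F, G, fun c => le_antisymm ((le_iff _ _ _ _ (hG _) (hF c)).2 le_rfl)
      ((le_iff _ _ _ _ (hF c) (hG _)).2 le_rfl),
    fun c' => le_antisymm ((le_iff _ _ _ _ (hF _) (hG c')).1 le_rfl)
      ((le_iff _ _ _ _ (hG c') (hF _)).1 le_rfl)⟩
  exact ⟨⟨E, fun {a b} => (le_iff _ _ _ _ (hF a) (hF b)).symm⟩⟩

/-! ### Clopen sets and the compact-open topology. -/

theorem IsClopen.image_homeomorph {X Y : Type*} [TopologicalSpace X] [TopologicalSpace Y]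
    {C : Set X} (hC : IsClopen C) (f : X ≃ₜ Y) : IsClopen (f '' C) :=
  ⟨f.isClosed_image.2 hC.isClosed, f.isOpen_image.2 hC.isOpen⟩

namespace HomeoGroup

variable {X : Type*} [TopologicalSpace X]

/-- The homeomorphisms agreeing with `f` on each set of the family `𝒞`, as maps of sets. -/
def agreeing (f : HomeoGroup X) (𝒞 : Set (Set X)) : Set (HomeoGroup X) :=
  {g | ∀ C ∈ 𝒞, g.toHomeomorph '' C = f.toHomeomorph '' C}

theorem mem_agreeing_self (f : HomeoGroup X) (𝒞 : Set (Set X)) : f ∈ f.agreeing 𝒞 := fun _ _ => rfl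

theorem agreeing_anti (f : HomeoGroup X) {𝒞 𝒟 : Set (Set X)} (h : 𝒞 ⊆ 𝒟) :
    f.agreeing 𝒟 ⊆ f.agreeing 𝒞 := fun _ hg C hC => hg C (h hC)

theorem toHomeomorph_mul_image (f g : HomeoGroup X) (C : Set X) :
    (f * g).toHomeomorph '' C = f.toHomeomorph '' (g.toHomeomorph '' C) :=
  Set.image_comp f.toHomeomorph g.toHomeomorph C

theorem toHomeomorph_inv_image (f : HomeoGroup X) (C : Set X) :
    f⁻¹.toHomeomorph '' C = f.toHomeomorph ⁻¹' C :=
  f.toHomeomorph.toEquiv.image_symm_eq_preimage C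

theorem isOpen_setOf_image_eq [CompactSpace X] {C D : Set X} (hC : IsClopen C) (hD : IsClopen D) :
    IsOpen {f : HomeoGroup X | f.toHomeomorph '' C = D} := by
  have : {f : HomeoGroup X | f.toHomeomorph '' C = D} =
      {f : HomeoGroup X | f.toHomeomorph '' C ⊆ D} ∩
        {f : HomeoGroup X | f.toHomeomorph '' Cᶜ ⊆ Dᶜ} := by
    ext f
    simp only [Set.mem_inter_iff, Set.mem_ofPred_eq, Set.image_compl_eq f.toHomeomorph.bijective,
      Set.compl_subset_compl]
    exact Set.Subset.antisymm_iff
  rw [this]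
  exact IsOpen.inter
    (.basic _ ⟨C, D, hC.isClosed.isCompact, hD.isOpen, rfl⟩)
    (.basic _ ⟨Cᶜ, Dᶜ, hC.compl.isClosed.isCompact, hD.compl.isOpen, rfl⟩)

/-- If `f` maps `K` into `V`, zero-dimensionality puts a clopen `C` between `K` and the preimage of
`V`; any `g` with the same image of `C` then maps `K` into `V`. -/
theorem exists_agreeing_subset [CompactSpace X] [T2Space X] [TotallyDisconnectedSpace X]
    {U : Set (HomeoGroup X)} (hU : IsOpen U) {f : HomeoGroup X} (hf : f ∈ U) :
    ∃ 𝒞 : Set (Set X), 𝒞.Countable ∧ (∀ C ∈ 𝒞, IsClopen C) ∧ f.agreeing 𝒞 ⊆ U := by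
  induction hU with
  | basic s hs =>
    obtain ⟨K, V, hK, hV, rfl⟩ := hs
    obtain ⟨C, hC, hKC, hCV⟩ := exists_clopen_of_closed_subset_open hK.isClosed
      (hV.preimage f.toHomeomorph.continuous) (Set.image_subset_iff.1 hf)
    refine ⟨{C}, Set.countable_singleton C, by simpa using hC, fun g hg => ?_⟩
    exact (Set.image_mono hKC).trans ((hg C rfl).trans_subset (Set.image_subset_iff.2 hCV))
  | univ => exact ⟨∅, Set.countable_empty, by simp, Set.subset_univ _⟩
  | inter s t _ _ hs ht =>
    obtain ⟨𝒞, h𝒞, h𝒞', hs⟩ := hs hf.1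
    obtain ⟨𝒟, h𝒟, h𝒟', ht⟩ := ht hf.2
    refine ⟨𝒞 ∪ 𝒟, h𝒞.union h𝒟, ?_, ?_⟩
    · rintro C (hC | hC)
      exacts [h𝒞' C hC, h𝒟' C hC]
    · exact Set.subset_inter ((agreeing_anti f Set.subset_union_left).trans hs)
        ((agreeing_anti f Set.subset_union_right).trans ht)
  | sUnion S _ ih =>
    obtain ⟨s, hs, hfs⟩ := hf
    obtain ⟨𝒞, h𝒞, h𝒞', h⟩ := ih s hs hfs
    exact ⟨𝒞, h𝒞, h𝒞', h.trans (Set.subset_sUnion_of_mem hs)⟩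

theorem isGδ_agreeing [CompactSpace X] (f : HomeoGroup X) {𝒞 : Set (Set X)} (h𝒞 : 𝒞.Countable)
    (h : ∀ C ∈ 𝒞, IsClopen C) : IsGδ (f.agreeing 𝒞) := by
  have : f.agreeing 𝒞 = ⋂ C ∈ 𝒞, {g : HomeoGroup X | g.toHomeomorph '' C = f.toHomeomorph '' C} := by
    ext g
    simp [agreeing]
  rw [this]
  exact IsGδ.biInter h𝒞 fun C hC => (isOpen_setOf_image_eq (h C hC)
    ((h C hC).image_homeomorph _)).isGδ

end HomeoGroup

/-! ### The `G_δ`-modification as a `P`-group of weight at most `𝔠`. -/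

namespace GDeltaModification

open HomeoGroup

variable {X : Type*} [TopologicalSpace X] [CompactSpace X]

theorem isOpen_agreeing (f : HomeoGroup X) {𝒞 : Set (Set X)} (h𝒞 : 𝒞.Countable)
    (h : ∀ C ∈ 𝒞, IsClopen C) :
    IsOpen (X := GDeltaModification (HomeoGroup X)) (f.agreeing 𝒞) :=
  (GDeltaModification.isTopologicalBasis (HomeoGroup X)).isOpen (isGδ_agreeing f h𝒞 h)

variable [T2Space X] [TotallyDisconnectedSpace X]

/-- A `G_δ` imposes countably many open conditions, each secured by a countable clopen family; the
union of these families is again countable. -/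
theorem isOpen_iff_exists_agreeing {U : Set (HomeoGroup X)} :
    IsOpen (X := GDeltaModification (HomeoGroup X)) U ↔ ∀ f ∈ U, ∃ 𝒞 : Set (Set X),
      𝒞.Countable ∧ (∀ C ∈ 𝒞, IsClopen C) ∧ f.agreeing 𝒞 ⊆ U := by
  constructor
  · intro hU f hf
    obtain ⟨s, ⟨T, hT, hTc, rfl⟩, hfs, hsU⟩ :=
      (GDeltaModification.isTopologicalBasis (HomeoGroup X)).exists_subset_of_mem_open hf hU
    have : ∀ t : T, ∃ 𝒞 : Set (Set X),
        𝒞.Countable ∧ (∀ C ∈ 𝒞, IsClopen C) ∧ f.agreeing 𝒞 ⊆ t.1 := fun t =>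
      exists_agreeing_subset (hT t t.2) (hfs t t.2)
    choose 𝒞 h𝒞 h𝒞' h using this
    have := hTc.to_subtype
    refine ⟨⋃ t, 𝒞 t, Set.countable_iUnion h𝒞, ?_, ?_⟩
    · intro C hC
      obtain ⟨t, ht⟩ := Set.mem_iUnion.1 hC
      exact h𝒞' t C ht
    · exact (Set.subset_sInter fun t ht =>
        (agreeing_anti f (Set.subset_iUnion 𝒞 ⟨t, ht⟩)).trans (h ⟨t, ht⟩)).trans hsU
  · intro h
    refine isOpen_iff_forall_mem_open.2 fun f hf => ?_
    obtain ⟨𝒞, h𝒞, h𝒞', hU⟩ := h f hf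
    exact ⟨_, hU, isOpen_agreeing f h𝒞 h𝒞', mem_agreeing_self f 𝒞⟩

theorem isOpen_of_isGδ_homeoGroup (s : Set (GDeltaModification (HomeoGroup X))) (hs : IsGδ s) :
    IsOpen s := by
  obtain ⟨T, hT, hTc, rfl⟩ := hs
  refine isOpen_iff_exists_agreeing.2 fun f hf => ?_
  have : ∀ t : T, ∃ 𝒞 : Set (Set X),
      𝒞.Countable ∧ (∀ C ∈ 𝒞, IsClopen C) ∧ f.agreeing 𝒞 ⊆ t.1 := fun t =>
    isOpen_iff_exists_agreeing.1 (hT t t.2) f (hf t t.2)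
  choose 𝒞 h𝒞 h𝒞' h using this
  have := hTc.to_subtype
  refine ⟨⋃ t, 𝒞 t, Set.countable_iUnion h𝒞, ?_, ?_⟩
  · intro C hC
    obtain ⟨t, ht⟩ := Set.mem_iUnion.1 hC
    exact h𝒞' t C ht
  · exact Set.subset_sInter fun t ht =>
      (agreeing_anti f (Set.subset_iUnion 𝒞 ⟨t, ht⟩)).trans (h ⟨t, ht⟩)

instance instIsTopologicalGroup : IsTopologicalGroup (GDeltaModification (HomeoGroup X)) where
  continuous_mul := by
    refine continuous_def.2 fun U hU => isOpen_prod_iff.2 fun f g hfg => ?_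
    obtain ⟨𝒞, h𝒞, h𝒞', h⟩ := isOpen_iff_exists_agreeing.1 hU _ hfg
    -- The left factor must be controlled on the images under `g`, the right factor on `𝒞` itself.
    refine ⟨HomeoGroup.agreeing f ((fun C => HomeoGroup.toHomeomorph g '' C) '' 𝒞),
      HomeoGroup.agreeing g 𝒞, isOpen_agreeing _ (h𝒞.image _) ?_, isOpen_agreeing _ h𝒞 h𝒞',
      mem_agreeing_self _ _, mem_agreeing_self _ _, ?_⟩
    · rintro _ ⟨C, hC, rfl⟩
      exact (h𝒞' C hC).image_homeomorph _
    · rintro ⟨f', g'⟩ ⟨hf', hg'⟩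
      refine h fun C hC => ?_
      refine (toHomeomorph_mul_image f' g' C).trans ((?_ : _ = _).trans
        (toHomeomorph_mul_image f g C).symm)
      rw [hg' C hC, hf' _ ⟨C, hC, rfl⟩]
  continuous_inv := by
    refine continuous_def.2 fun U hU => isOpen_iff_exists_agreeing.2 fun f hf => ?_
    obtain ⟨𝒞, h𝒞, h𝒞', h⟩ := isOpen_iff_exists_agreeing.1 hU _ hf
    refine ⟨(fun C => f.toHomeomorph ⁻¹' C) '' 𝒞, h𝒞.image _, ?_, fun g hg => h fun C hC => ?_⟩
    · rintro _ ⟨C, hC, rfl⟩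
      exact (h𝒞' C hC).preimage f.toHomeomorph.continuous
    · have hg := hg _ ⟨C, hC, rfl⟩
      dsimp only at hg
      rw [Set.image_preimage_eq _ f.toHomeomorph.surjective] at hg
      refine (toHomeomorph_inv_image g C).trans ((?_ : _ = _).trans
        (toHomeomorph_inv_image f C).symm)
      conv_lhs => rw [← hg]
      exact Set.preimage_image_eq _ g.toHomeomorph.injective

theorem eq_of_forall_isClopen {x y : X} (h : ∀ C : Set X, IsClopen C → x ∈ C → y ∈ C) : x = y := by
  by_contra hxy
  obtain ⟨C, hC, hx, hy⟩ := exists_isClopen_of_totally_separated hxy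
  exact hy (h C hC hx)

instance instT35Space : T35Space (GDeltaModification (HomeoGroup X)) := by
  have : T1Space (GDeltaModification (HomeoGroup X)) := by
    refine t1Space_iff_exists_open.2 fun f g hfg => ?_
    have : ∃ C : Set X, IsClopen C ∧ HomeoGroup.toHomeomorph f '' C ≠ HomeoGroup.toHomeomorph g '' C := by
      by_contra! h
      refine hfg (Homeomorph.ext fun x => eq_of_forall_isClopen fun C hC hx => ?_ : f = g)
      have h' := h (HomeoGroup.toHomeomorph f ⁻¹' C) (hC.preimage (Homeomorph.continuous _))
      rw [Set.image_preimage_eq _ (Homeomorph.surjective _)] at h'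
      rw [h']
      exact ⟨x, hx, rfl⟩
    obtain ⟨C, hC, hne⟩ := this
    refine ⟨HomeoGroup.agreeing f {C}, isOpen_agreeing f (Set.countable_singleton C) (by simpa),
      mem_agreeing_self _ _, fun h => hne (h C rfl).symm⟩
  -- Complete regularity comes from the group uniformity.
  let := IsTopologicalGroup.rightUniformSpace (GDeltaModification (HomeoGroup X))
  exact { }

theorem isTopologicalPGroup_homeoGroup :
    IsTopologicalPGroup (GDeltaModification (HomeoGroup X)) where
  isTopologicalGroup := inferInstance
  tychonoff := inferInstance
  isOpen_of_isGδ := isOpen_of_isGδ_homeoGroup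

theorem weight_homeoGroup_le {X : Type} [TopologicalSpace X] [CompactSpace X] [T2Space X]
    [TotallyDisconnectedSpace X]
    (hX : Cardinal.mk (TopologicalSpace.Clopens X) ≤ Cardinal.continuum) :
    weight (GDeltaModification (HomeoGroup X)) ≤ Cardinal.continuum := by
  let W : (ℕ → TopologicalSpace.Clopens X × TopologicalSpace.Clopens X) →
      Set (GDeltaModification (HomeoGroup X)) := fun σ =>
    {f | ∀ n, HomeoGroup.toHomeomorph f '' (σ n).1 = (σ n).2}
  have hW : TopologicalSpace.IsTopologicalBasis (Set.range W) := by
    refine TopologicalSpace.isTopologicalBasis_of_isOpen_of_nhds ?_ ?_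
    · rintro _ ⟨σ, rfl⟩
      refine isOpen_iff_exists_agreeing.2 fun f hf =>
        ⟨Set.range fun n => (σ n).1, Set.countable_range _, ?_, fun g hg n => ?_⟩
      · rintro _ ⟨n, rfl⟩
        exact (σ n).1.isClopen
      · exact (hg _ ⟨n, rfl⟩).trans (hf n)
    · intro f U hf hU
      obtain ⟨𝒞, h𝒞, h𝒞', h⟩ := isOpen_iff_exists_agreeing.1 hU f hf
      -- Adding `∅` makes the family nonempty, hence enumerable by `ℕ`.
      obtain ⟨e, he⟩ := (h𝒞.insert ∅).exists_eq_range (Set.insert_nonempty _ _)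
      have he' : ∀ n, IsClopen (e n) := fun n => by
        have : e n ∈ insert ∅ 𝒞 := he ▸ ⟨n, rfl⟩
        rcases this with h | h
        · exact h ▸ isClopen_empty
        · exact h𝒞' _ h
      refine ⟨_, ⟨fun n => (⟨e n, he' n⟩,
        ⟨HomeoGroup.toHomeomorph f '' e n, (he' n).image_homeomorph _⟩), rfl⟩,
        fun n => rfl, fun g hg => h fun C hC => ?_⟩
      obtain ⟨n, rfl⟩ : C ∈ Set.range e := he ▸ Set.mem_insert_of_mem _ hC
      exact hg n
  calc weight (GDeltaModification (HomeoGroup X)) ≤ Cardinal.mk (Set.range W) :=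
        csInf_le' ⟨_, hW, rfl⟩
    _ ≤ _ := Cardinal.mk_range_le
    _ ≤ (Cardinal.continuum * Cardinal.continuum) ^ Cardinal.aleph0 := by
        simpa only [Cardinal.mk_pi, Cardinal.prod_const, Cardinal.mk_prod, Cardinal.lift_id, Cardinal.mk_nat] using
          Cardinal.power_le_power_right (mul_le_mul' hX hX)
    _ = Cardinal.continuum := by simp

end GDeltaModification

/-! ### Stone duality for automorphisms. -/

open TopologicalSpace (Clopens)

section StoneDuality

variable {X : Type*} [TopologicalSpace X] [CompactSpace X]

/-- The images of the clopen neighbourhoods of `x` are directed, closed and nonempty, so compactness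
gives a common point; complements give the converse implication. -/
theorem exists_forall_mem_orderIso_clopens_iff (ψ : Clopens X ≃o Clopens X) (x : X) :
    ∃ y, ∀ C, y ∈ ψ C ↔ x ∈ C := by
  have : (⋂ C : {C : Clopens X // x ∈ C}, (ψ C : Set X)).Nonempty := by
    have : Nonempty {C : Clopens X // x ∈ C} := ⟨⟨⊤, trivial⟩⟩
    refine IsCompact.nonempty_iInter_of_directed_nonempty_isCompact_isClosed _ ?_ ?_
      (fun C => (ψ C).isClopen.isClosed.isCompact) (fun C => (ψ C).isClopen.isClosed)
    · rintro ⟨C, hC⟩ ⟨D, hD⟩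
      exact ⟨⟨C ⊓ D, hC, hD⟩, ψ.monotone inf_le_left, ψ.monotone inf_le_right⟩
    · rintro ⟨C, hC⟩
      by_contra h
      have h0 : ψ C = ψ ⊥ := by
        rw [OrderIso.map_bot]
        exact Clopens.ext (Set.not_nonempty_iff_eq_empty.1 h)
      rw [ψ.injective h0] at hC
      exact hC
  obtain ⟨y, hy⟩ := this
  rw [Set.mem_iInter] at hy
  refine ⟨y, fun C => ⟨fun h => ?_, fun h => hy ⟨C, h⟩⟩⟩
  by_contra hx
  have := hy ⟨Cᶜ, hx⟩
  rw [map_compl'] at this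
  exact this h

variable [T2Space X] [TotallyDisconnectedSpace X]

theorem eq_of_forall_mem_clopens {x y : X} (h : ∀ C : Clopens X, x ∈ C → y ∈ C) : x = y :=
  GDeltaModification.eq_of_forall_isClopen fun C hC => h ⟨C, hC⟩

/-- Stone duality for automorphisms: an automorphism of the algebra of clopen sets of a compact
totally disconnected Hausdorff space is induced by a homeomorphism. -/
theorem exists_homeomorph_forall_mem_iff (ψ : Clopens X ≃o Clopens X) :
    ∃ f : X ≃ₜ X, ∀ x C, f x ∈ ψ C ↔ x ∈ C := by
  choose F hF using exists_forall_mem_orderIso_clopens_iff ψ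
  choose F' hF' using exists_forall_mem_orderIso_clopens_iff ψ.symm
  have hF'' : ∀ x C, F' x ∈ C ↔ x ∈ ψ C := fun x C => by
    rw [← hF' x (ψ C), OrderIso.symm_apply_apply]
  have cont : ∀ (ψ : Clopens X ≃o Clopens X) (F : X → X), (∀ x C, F x ∈ ψ C ↔ x ∈ C) →
      Continuous F := fun ψ F hF => by
    refine (isTopologicalBasis_isClopen (X := X)).continuous_iff.2 fun C hC => ?_
    have : F ⁻¹' C = ψ.symm ⟨C, hC⟩ := by
      ext x
      rw [SetLike.mem_coe, ← hF, OrderIso.apply_symm_apply]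
      rfl
    rw [this]
    exact (ψ.symm ⟨C, hC⟩).isClopen.isOpen
  refine ⟨⟨⟨F, F', fun x => ?_, fun x => ?_⟩, cont ψ F hF, cont ψ.symm F' hF'⟩, hF⟩
  · exact (eq_of_forall_mem_clopens fun C hC => by rwa [hF'', hF]).symm
  · refine (eq_of_forall_mem_clopens fun C hC => ?_).symm
    rw [← ψ.apply_symm_apply C] at hC ⊢
    rwa [hF, hF'']

/-- The homomorphism from the automorphism group of the algebra of clopen sets to the
homeomorphism group given by Stone duality. -/
noncomputable def homeoGroupOfClopens : (Clopens X ≃o Clopens X) →* HomeoGroup X :=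
  MonoidHom.mk' (fun ψ => (exists_homeomorph_forall_mem_iff ψ).choose) fun ψ φ =>
    Homeomorph.ext fun x => eq_of_forall_mem_clopens fun C hC => by
      obtain ⟨D, rfl⟩ := (ψ * φ).surjective C
      have h := (exists_homeomorph_forall_mem_iff (ψ * φ)).choose_spec
      have hψ := (exists_homeomorph_forall_mem_iff ψ).choose_spec
      have hφ := (exists_homeomorph_forall_mem_iff φ).choose_spec
      rw [h] at hC
      exact (hψ _ (φ D)).2 ((hφ x D).2 hC)

theorem homeoGroupOfClopens_image (ψ : Clopens X ≃o Clopens X) (C : Clopens X) :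
    (homeoGroupOfClopens ψ).toHomeomorph '' C = ψ C := by
  have h : ∀ x C, (homeoGroupOfClopens ψ).toHomeomorph x ∈ ψ C ↔ x ∈ C :=
    (exists_homeomorph_forall_mem_iff ψ).choose_spec
  ext y
  obtain ⟨x, rfl⟩ := (homeoGroupOfClopens ψ).toHomeomorph.surjective y
  rw [(homeoGroupOfClopens ψ).toHomeomorph.injective.mem_set_image, SetLike.mem_coe,
    SetLike.mem_coe, h]

end StoneDuality

/-- A `P`-group acting on a Boolean algebra isomorphic to the algebra of clopen sets of `X`, so that
stabilizers of elements form a local subbase at the identity, embeds into the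
`G_δ`-modification of the homeomorphism group of `X`. -/
theorem IsTopologicalPGroup.exists_subgroup_homeoGroup {G X C : Type*} [Group G]
    [TopologicalSpace G] (hG : IsTopologicalPGroup G) [TopologicalSpace X] [CompactSpace X]
    [T2Space X] [TotallyDisconnectedSpace X] [PartialOrder C] (θ : C ≃o Clopens X)
    (ρ : G →* (C ≃o C)) (hρ : ∀ c, {g | ρ g c = c} ∈ 𝓝 (1 : G))
    (hρ' : ∀ U ∈ 𝓝 (1 : G), ∃ c, {g | ρ g c = c} ⊆ U) :
    ∃ S : Subgroup (GDeltaModification (HomeoGroup X)), Nonempty (G ≃ₜ* S) := by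
  have := hG.isTopologicalGroup
  have := hG.tychonoff
  let Ψ : G →* (Clopens X ≃o Clopens X) := MonoidHom.mk' (fun g => (θ.symm.trans (ρ g)).trans θ)
    fun g h =>
      DFunLike.ext _ _ fun D => by simp [RelIso.mul_apply]
  let Φ : G →* GDeltaModification (HomeoGroup X) := (homeoGroupOfClopens (X := X)).comp Ψ
  have Φ_image : ∀ g (D : Clopens X), HomeoGroup.toHomeomorph (Φ g) '' D = Ψ g D := fun g D =>
    homeoGroupOfClopens_image (Ψ g) D
  have one_image : ∀ D : Set X, HomeoGroup.toHomeomorph (1 : HomeoGroup X) '' D = D :=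
    fun D => Set.image_id D
  have Ψ_eq : ∀ g D, Ψ g D = D ↔ ρ g (θ.symm D) = θ.symm D := fun g D =>
    (OrderIso.eq_symm_apply θ).symm
  have ind : IsInducing Φ := by
    refine IsTopologicalGroup.isInducing_iff_nhds_one.2 (le_antisymm ?_ ?_)
    · refine Filter.map_le_iff_le_comap.1 fun V hV => ?_
      obtain ⟨W, hWV, hW, h1⟩ := mem_nhds_iff.1 hV
      obtain ⟨𝒞, h𝒞, h𝒞', h⟩ := GDeltaModification.isOpen_iff_exists_agreeing.1 hW _ h1
      have := h𝒞.to_subtype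
      change Φ ⁻¹' V ∈ 𝓝 1
      -- Here the `P`-property handles countably many clopen sets at once.
      have hmem : (⋂ C : 𝒞, interior {g | ρ g (θ.symm ⟨C, h𝒞' C C.2⟩) = θ.symm ⟨C, h𝒞' C C.2⟩}) ∈
          𝓝 (1 : G) :=
        (hG.isOpen_of_isGδ _ (IsGδ.iInter fun C => isOpen_interior.isGδ)).mem_nhds
          (Set.mem_iInter.2 fun C => mem_interior_iff_mem_nhds.2 (hρ _))
      refine Filter.mem_of_superset hmem fun g hg => hWV (h fun C hC => ?_)
      have hg := interior_subset (Set.mem_iInter.1 hg ⟨C, hC⟩)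
      refine (Φ_image g ⟨C, h𝒞' C hC⟩).trans (Eq.trans ?_ (one_image C).symm)
      exact congrArg _ ((Ψ_eq g _).2 hg)
    · intro U hU
      obtain ⟨c, hc⟩ := hρ' U hU
      refine ⟨HomeoGroup.agreeing (1 : HomeoGroup X) {(θ c : Set X)}, ?_, fun g hg => hc ?_⟩
      · exact (GDeltaModification.isOpen_agreeing _ (Set.countable_singleton _)
          (by simpa using (θ c).isClopen)).mem_nhds (HomeoGroup.mem_agreeing_self _ _)
      · have : Ψ g (θ c) = θ c :=
          SetLike.coe_injective ((Φ_image g (θ c)).symm.trans ((hg _ rfl).trans (one_image _)))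
        rw [Ψ_eq, OrderIso.symm_apply_apply] at this
        exact this
  let e : G ≃ₜ Φ.range := ind.isEmbedding.toHomeomorph
  exact ⟨Φ.range, ⟨{ e with map_mul' := fun g h => Subtype.ext (map_mul Φ g h) }⟩⟩

/-! ### The clopen algebra of `ω*`. -/

section OmegaStar

instance : ExtremallyDisconnected (StoneCech ℕ) :=
  CompactT2.Projective.extremallyDisconnected StoneCech.projective

/-- The indicator of `n` extends to `βω`. Its open support meets the dense set `ω` only in `n`, so
it is `{n}`. -/
theorem isOpen_image_stoneCechUnit (A : Set ℕ) : IsOpen (stoneCechUnit '' A) := by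
  have single : ∀ n : ℕ, IsOpen {(stoneCechUnit n : StoneCech ℕ)} := fun n => by
    have hg : Continuous fun m : ℕ => decide (m = n) := continuous_of_discreteTopology
    have hopen : IsOpen (stoneCechExtend hg ⁻¹' {true}) :=
      (isOpen_discrete _).preimage (continuous_stoneCechExtend hg)
    have : stoneCechExtend hg ⁻¹' {true} = {stoneCechUnit n} := by
      refine Set.Subset.antisymm ?_ ?_
      · refine (denseRange_stoneCechUnit.open_subset_closure_inter hopen).trans
          (closure_minimal ?_ isClosed_singleton)
        rintro _ ⟨h, m, rfl⟩
        simpa [stoneCechExtend_stoneCechUnit, ← decide_eq_true_iff (p := m = n)] using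
          congrArg stoneCechUnit (by simpa [stoneCechExtend_stoneCechUnit] using h : m = n)
      · rintro _ rfl
        simp [stoneCechExtend_stoneCechUnit]
    rwa [this] at hopen
  rw [← Set.biUnion_of_singleton (stoneCechUnit '' A)]
  refine isOpen_biUnion ?_
  rintro _ ⟨n, -, rfl⟩
  exact single n

theorem isClopen_closure_image_stoneCechUnit (A : Set ℕ) :
    IsClopen (closure (stoneCechUnit '' A : Set (StoneCech ℕ))) :=
  ⟨isClosed_closure, ExtremallyDisconnected.open_closure _ (isOpen_image_stoneCechUnit A)⟩

instance : CompactSpace OmegaStar :=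
  isCompact_iff_compactSpace.1 <| IsClosed.isCompact <| by
    have := (isOpen_image_stoneCechUnit Set.univ).isClosed_compl
    rw [Set.image_univ] at this
    exact this

/-- The clopen set `A* = cl A \ ω` of `ω*`. -/
def OmegaStar.clopen (A : Set ℕ) : Clopens OmegaStar :=
  ⟨Subtype.val ⁻¹' closure (stoneCechUnit '' A),
    (isClopen_closure_image_stoneCechUnit A).preimage continuous_subtype_val⟩

/-- A clopen set and its complement are disjoint compact sets in `βω`. A clopen `W` separates them,
and `W` is the closure of its trace on `ω`. -/
theorem OmegaStar.surjective_clopen : Function.Surjective OmegaStar.clopen := by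
  intro V
  have hV : IsClosed (Subtype.val '' (V : Set OmegaStar)) :=
    (V.isClopen.isClosed.isCompact.image continuous_subtype_val).isClosed
  have hV' : IsClosed (Subtype.val '' (V : Set OmegaStar)ᶜ) :=
    (V.isClopen.compl.isClosed.isCompact.image continuous_subtype_val).isClosed
  obtain ⟨W, hW, hVW, hWV⟩ := exists_clopen_of_closed_subset_open hV hV'.isOpen_compl
    (by rintro _ ⟨x, hx, rfl⟩ ⟨y, hy, hxy⟩; exact hy (Subtype.ext hxy ▸ hx))
  refine ⟨stoneCechUnit ⁻¹' W, Clopens.ext ?_⟩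
  have : closure (stoneCechUnit '' (stoneCechUnit ⁻¹' W)) = W := by
    rw [Set.image_preimage_eq_inter_range]
    exact (closure_minimal Set.inter_subset_left hW.isClosed).antisymm
      (denseRange_stoneCechUnit.open_subset_closure_inter hW.isOpen)
  ext x
  change x.1 ∈ closure _ ↔ x ∈ V
  rw [this]
  refine ⟨fun h => ?_, fun h => hVW ⟨x, h, rfl⟩⟩
  by_contra hx
  exact hWV h ⟨x, hx, rfl⟩

theorem OmegaStar.exists_mem_clopen {A : Set ℕ} (hA : A.Infinite) : ∃ x, x ∈ OmegaStar.clopen A := by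
  by_contra! h
  have hsub : closure (stoneCechUnit '' A : Set (StoneCech ℕ)) ⊆
      ⋃ n : ℕ, stoneCechUnit '' ({n} : Set ℕ) := by
    intro x hx
    by_contra hx'
    refine h ⟨x, ?_⟩ hx
    rintro ⟨n, rfl⟩
    exact hx' (Set.mem_iUnion.2 ⟨n, n, rfl, rfl⟩)
  obtain ⟨t, ht⟩ := isClosed_closure.isCompact.elim_finite_subcover _
    (fun n => isOpen_image_stoneCechUnit {n}) hsub
  refine hA (t.finite_toSet.subset fun n hn => ?_)
  obtain ⟨m, hm, h⟩ := Set.mem_iUnion₂.1 (ht (subset_closure ⟨n, hn, rfl⟩))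
  rw [Set.image_singleton, Set.mem_singleton_iff] at h
  rwa [isEmbedding_stoneCechUnit.injective h]

/-- If `A \ B` is infinite, its closure has a point in `ω*` and misses the closure of `B`; if
finite, it adds only points of `ω`. -/
theorem OmegaStar.clopen_le_iff {A B : Set ℕ} :
    OmegaStar.clopen A ≤ OmegaStar.clopen B ↔ (A \ B).Finite := by
  constructor
  · intro h
    by_contra hfin
    obtain ⟨x, hx⟩ := OmegaStar.exists_mem_clopen hfin
    have hxB : x ∈ OmegaStar.clopen B :=
      h (closure_mono (Set.image_mono Set.sdiff_subset) hx : x ∈ OmegaStar.clopen A)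
    have hdisj : Disjoint (stoneCechUnit '' (A \ B) : Set (StoneCech ℕ)) (stoneCechUnit '' B) :=
      (Set.disjoint_image_iff isEmbedding_stoneCechUnit.injective).2 Set.disjoint_sdiff_left
    exact Set.disjoint_left.1 ((hdisj.closure_left (isOpen_image_stoneCechUnit B)).closure_right
      (isClopen_closure_image_stoneCechUnit (A \ B)).isOpen) hx hxB
  · intro h x hx
    have hx : x.1 ∈ closure (stoneCechUnit '' A) := hx
    have hfin : IsClosed (stoneCechUnit '' (A \ B) : Set (StoneCech ℕ)) := (h.image _).isClosed
    have := closure_mono (Set.image_mono (f := (stoneCechUnit : ℕ → StoneCech ℕ))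
      (Set.subset_sdiff_union A B)) hx
    rw [Set.image_union, closure_union, hfin.closure_eq] at this
    rcases this with ⟨n, -, hn⟩ | h
    · exact (x.2 ⟨n, hn⟩).elim
    · exact h

open Filter in
/-- The algebra of clopen subsets of `ω*` is the power set of `ω` modulo finite sets. -/
theorem OmegaStar.nonempty_germ_orderIso_clopens :
    Nonempty (Germ (atTop : Filter ℕ) Prop ≃o Clopens OmegaStar) := by
  have le_iff : ∀ A B : ℕ → Prop, OmegaStar.clopen {n | A n} ≤ OmegaStar.clopen {n | B n} ↔
      (A : Germ (atTop : Filter ℕ) Prop) ≤ B := fun A B => by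
    rw [OmegaStar.clopen_le_iff, Germ.coe_le, EventuallyLE, ← Nat.cofinite_eq_atTop,
      eventually_cofinite]
    refine iff_of_eq (congrArg Set.Finite (Set.ext fun n => ?_))
    simp
  let F : Germ (atTop : Filter ℕ) Prop → Clopens OmegaStar := fun a =>
    Germ.liftOn a (fun A => OmegaStar.clopen {n | A n}) fun A B hAB =>
      le_antisymm ((le_iff A B).2 (Germ.coe_eq.2 hAB).le) ((le_iff B A).2 (Germ.coe_eq.2 hAB).ge)
  have F_le : ∀ a b, F a ≤ F b ↔ a ≤ b := fun a b =>
    Germ.inductionOn₂ a b fun A B => le_iff A B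
  refine ⟨RelIso.ofSurjective (OrderEmbedding.ofMapLEIff F F_le) ?_⟩
  intro V
  obtain ⟨A, rfl⟩ := OmegaStar.surjective_clopen V
  exact ⟨((fun n => n ∈ A : ℕ → Prop) : Germ (atTop : Filter ℕ) Prop), rfl⟩

theorem OmegaStar.mk_clopens_le : Cardinal.mk (Clopens OmegaStar) ≤ Cardinal.continuum :=
  (Cardinal.mk_le_of_surjective OmegaStar.surjective_clopen).trans (by simp)

end OmegaStar

/-! ### From a group action to an embedding. -/

open scoped Pointwise

/-- The algebra of finite and cofinite subsets of a type. -/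
def finiteCofinite (Y : Type*) : BooleanSubalgebra (Set Y) where
  carrier := {s | s.Finite ∨ sᶜ.Finite}
  supClosed' := by
    rintro s hs t ht
    change (s ∪ t).Finite ∨ (s ∪ t)ᶜ.Finite
    rw [Set.compl_union]
    rcases hs with hs | hs
    · rcases ht with ht | ht
      · exact Or.inl (hs.union ht)
      · exact Or.inr (ht.subset Set.inter_subset_right)
    · exact Or.inr (hs.subset Set.inter_subset_left)
  infClosed' := by
    rintro s hs t ht
    change (s ∩ t).Finite ∨ (s ∩ t)ᶜ.Finite
    rw [Set.compl_inter]
    rcases hs with hs | hs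
    · exact Or.inl (hs.subset Set.inter_subset_left)
    · rcases ht with ht | ht
      · exact Or.inl (ht.subset Set.inter_subset_right)
      · exact Or.inr (hs.union ht)
  compl_mem' := by
    rintro s (hs | hs)
    · exact Or.inr (by rwa [compl_compl])
    · exact Or.inl hs
  bot_mem' := Or.inl Set.finite_empty

theorem mk_finiteCofinite_le {Y : Type*} (hY : Cardinal.mk Y ≤ Cardinal.continuum) :
    Cardinal.mk (finiteCofinite Y) ≤ Cardinal.continuum := by
  classical
  have hF : Cardinal.mk (Finset Y) ≤ Cardinal.continuum := by
    rcases finite_or_infinite Y with h | h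
    · exact (Cardinal.mk_lt_aleph0 (α := Finset Y)).le.trans Cardinal.aleph0_le_continuum
    · rwa [Cardinal.mk_finset_of_infinite]
  let F : Finset Y ⊕ Finset Y → finiteCofinite Y := Sum.elim
    (fun s => ⟨s, Or.inl s.finite_toSet⟩) fun s => ⟨(s : Set Y)ᶜ, Or.inr (by simp)⟩
  have hsurj : Function.Surjective F := by
    rintro ⟨s, hs | hs⟩
    · exact ⟨Sum.inl hs.toFinset, Subtype.ext (by simp [F])⟩
    · exact ⟨Sum.inr hs.toFinset, Subtype.ext (by simp [F])⟩
  refine (Cardinal.mk_le_of_surjective hsurj).trans ?_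
  rw [Cardinal.mk_sum, Cardinal.lift_id]
  exact (add_le_add hF hF).trans (by simp)

section Action

variable {G Y : Type*} [Group G] [MulAction G Y]

/-- The action of a group on the finite and cofinite subsets of a `G`-set. -/
def finiteCofiniteHom (G Y : Type*) [Group G] [MulAction G Y] :
    G →* (finiteCofinite Y ≃o finiteCofinite Y) where
  toFun g :=
    { toFun s := ⟨g • s.1, s.2.imp (fun h => h.smul_set) fun h => by
        rw [← Set.smul_set_compl]
        exact h.smul_set⟩
      invFun s := ⟨g⁻¹ • s.1, s.2.imp (fun h => h.smul_set) fun h => by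
        rw [← Set.smul_set_compl]
        exact h.smul_set⟩
      left_inv s := Subtype.ext (inv_smul_smul g s.1)
      right_inv s := Subtype.ext (smul_inv_smul g s.1)
      map_rel_iff' := Set.smul_set_subset_smul_set_iff }
  map_one' := DFunLike.ext _ _ fun s => Subtype.ext (one_smul G s.1)
  map_mul' g h := DFunLike.ext _ _ fun s => Subtype.ext (mul_smul g h s.1)

open Filter in
/-- The action on a reduced power induced by an action by automorphisms. -/
def Filter.Germ.orderIsoHom {α B : Type*} [PartialOrder B] (l : Filter α) :
    (B ≃o B) →* (Germ l B ≃o Germ l B) where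
  toFun e :=
    { toFun := Germ.map e
      invFun := Germ.map e.symm
      left_inv a := Germ.inductionOn a fun f => by
        rw [Germ.map_coe, Germ.map_coe]
        exact congrArg _ (funext fun k => e.symm_apply_apply (f k))
      right_inv a := Germ.inductionOn a fun f => by
        rw [Germ.map_coe, Germ.map_coe]
        exact congrArg _ (funext fun k => e.apply_symm_apply (f k))
      map_rel_iff' {a b} := Germ.inductionOn₂ a b fun f f' => by
        change (↑(e ∘ f) : Germ l B) ≤ ↑(e ∘ f') ↔ _
        rw [Germ.coe_le, Germ.coe_le]
        exact eventually_congr (Eventually.of_forall fun k => e.le_iff_le) }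
  map_one' := DFunLike.ext _ _ fun a => Germ.inductionOn a fun _ => rfl
  map_mul' _ _ := DFunLike.ext _ _ fun a => Germ.inductionOn a fun _ => rfl

variable [TopologicalSpace G]

/-- Finitely many point stabilizers intersect in a neighbourhood fixing a finite set; cofinite sets
follow by complements. -/
theorem setOf_finiteCofiniteHom_eq_mem_nhds_one
    (hY : ∀ y : Y, (MulAction.stabilizer G y : Set G) ∈ 𝓝 1) (s : finiteCofinite Y) :
    {g | finiteCofiniteHom G Y g s = s} ∈ 𝓝 1 := by
  have fin : ∀ s : Set Y, s.Finite → {g : G | g • s = s} ∈ 𝓝 1 := fun s hs => by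
    filter_upwards [(Filter.biInter_mem hs).2 fun y _ => hY y] with g hg
    have hg : ∀ y ∈ s, g • y = y := fun y hy => Set.mem_iInter₂.1 hg y hy
    exact (Set.image_congr hg).trans (Set.image_id' s)
  obtain ⟨s, hs | hs⟩ := s
  · filter_upwards [fin s hs] with g hg using Subtype.ext hg
  · filter_upwards [fin sᶜ hs] with g hg
    refine Subtype.ext (compl_injective ?_)
    exact Set.smul_set_compl.symm.trans hg

open Filter in
/-- A `P`-group acting on a set of cardinality at most `𝔠` so that the point stabilizers
form a local base at the identity embeds into `𝓗(ω*)_(δ)`. -/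
theorem IsTopologicalPGroup.exists_subgroup_of_mulAction
    (CH : Cardinal.aleph 1 = (Cardinal.continuum : Cardinal.{0})) (hG : IsTopologicalPGroup G)
    (cY : Cardinal.mk Y ≤ Cardinal.continuum)
    (hY : ∀ y : Y, (MulAction.stabilizer G y : Set G) ∈ 𝓝 1)
    (hY' : ∀ U ∈ 𝓝 (1 : G), ∃ y : Y, (MulAction.stabilizer G y : Set G) ⊆ U) :
    ∃ S : Subgroup (GDeltaModification (HomeoGroup OmegaStar)), Nonempty (G ≃ₜ* S) := by
  obtain ⟨y₀, -⟩ := hY' Set.univ univ_mem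
  have : Nonempty Y := ⟨y₀⟩
  have : Nontrivial (finiteCofinite Y) := ⟨⊥, ⊤, fun h =>
    Set.empty_ne_univ (α := Y) (Subtype.ext_iff.1 h)⟩
  obtain ⟨θ⟩ := CountablySaturated.nonempty_orderIso CH
    (Germ.countablySaturated (finiteCofinite Y)) (Germ.countablySaturated Prop)
    ((Cardinal.mk_le_of_surjective Quotient.mk_surjective).trans (by
      simpa using Cardinal.power_le_power_right (c := Cardinal.aleph0) (mk_finiteCofinite_le cY)))
    ((Cardinal.mk_le_of_surjective Quotient.mk_surjective).trans (by simp))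
  obtain ⟨κ⟩ := OmegaStar.nonempty_germ_orderIso_clopens
  refine hG.exists_subgroup_homeoGroup (θ.trans κ)
    ((Germ.orderIsoHom atTop).comp (finiteCofiniteHom G Y)) (fun c => ?_) fun U hU => ?_
  · induction c using Germ.inductionOn with
    | h f =>
      have hmem : (⋂ n, interior {g | finiteCofiniteHom G Y g (f n) = f n}) ∈ 𝓝 (1 : G) :=
        (hG.isOpen_of_isGδ _ (IsGδ.iInter fun n => isOpen_interior.isGδ)).mem_nhds
          (Set.mem_iInter.2 fun n => mem_interior_iff_mem_nhds.2
            (setOf_finiteCofiniteHom_eq_mem_nhds_one hY (f n)))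
      refine mem_of_superset hmem fun g hg => ?_
      exact congrArg (Germ.ofFun (l := (atTop : Filter ℕ)))
        (funext fun n => show finiteCofiniteHom G Y g (f n) = f n from
          interior_subset (s := {g | finiteCofiniteHom G Y g (f n) = f n}) (Set.mem_iInter.1 hg n))
  · obtain ⟨y, hy⟩ := hY' U hU
    refine ⟨((⟨{y}, Or.inl (Set.finite_singleton y)⟩ : finiteCofinite Y) :
      Germ atTop (finiteCofinite Y)), fun g hg => hy ?_⟩
    have : g • ({y} : Set Y) = {y} := Subtype.ext_iff.1 (Germ.const_inj.1 hg)
    rwa [Set.smul_set_singleton, Set.singleton_eq_singleton_iff] at this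

end Action

/-! ### Open subgroups and the universal embedding. -/

section PGroup

variable {G : Type*} [Group G] [TopologicalSpace G]

/-- Symmetric neighbourhoods, each with its square inside the previous one, intersect in a subgroup;
the `P`-property makes it open. -/
theorem IsTopologicalPGroup.exists_subgroup_subset (hG : IsTopologicalPGroup G) {U : Set G}
    (hU : U ∈ 𝓝 (1 : G)) : ∃ H : Subgroup G, IsOpen (H : Set G) ∧ (H : Set G) ⊆ U := by
  have := hG.isTopologicalGroup
  have step : ∀ U : {U : Set G // U ∈ 𝓝 (1 : G)}, ∃ V : {V : Set G // V ∈ 𝓝 (1 : G)},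
      V.1⁻¹ = V.1 ∧ V.1 * V.1 ⊆ U.1 := fun U => by
    obtain ⟨V, hV, -, hinv, hmul⟩ := exists_closed_nhds_one_inv_eq_mul_subset U.2
    exact ⟨⟨V, hV⟩, hinv, hmul⟩
  choose next hinv hmul using step
  -- The shift by one omits `U` itself, which need not be symmetric.
  let V : ℕ → {U : Set G // U ∈ 𝓝 (1 : G)} := fun n => next^[n + 1] ⟨U, hU⟩
  have V_succ : ∀ n, V (n + 1) = next (V n) := fun n => Function.iterate_succ_apply' _ _ _
  have V_inv : ∀ n, (V n).1⁻¹ = (V n).1 := fun n => by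
    simp only [V, Function.iterate_succ_apply', hinv]
  have V_mul : ∀ n, (V (n + 1)).1 * (V (n + 1)).1 ⊆ (V n).1 := fun n => V_succ n ▸ hmul (V n)
  have one_mem : ∀ n, (1 : G) ∈ (V n).1 := fun n => mem_of_mem_nhds (V n).2
  let H : Subgroup G :=
    { carrier := ⋂ n, (V n).1
      mul_mem' := fun ha hb => Set.mem_iInter.2 fun n => V_mul n
        (Set.mul_mem_mul (Set.mem_iInter.1 ha (n + 1)) (Set.mem_iInter.1 hb (n + 1)))
      one_mem' := Set.mem_iInter.2 one_mem
      inv_mem' := fun {a} ha => Set.mem_iInter.2 fun n => by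
        rw [← V_inv, Set.inv_mem_inv]
        exact Set.mem_iInter.1 ha n }
  refine ⟨H, Subgroup.isOpen_of_mem_nhds H (g := 1) ?_, fun x hx => ?_⟩
  · refine Filter.mem_of_superset ((hG.isOpen_of_isGδ _ (IsGδ.iInter fun n =>
      (isOpen_interior (s := (V n).1)).isGδ)).mem_nhds
        (Set.mem_iInter.2 fun n => mem_interior_iff_mem_nhds.2 (V n).2))
      (Set.iInter_mono fun n => interior_subset)
  · have := hmul ⟨U, hU⟩ (Set.mul_mem_mul (Set.mem_iInter.1 hx 0) (one_mem 0))
    rwa [mul_one] at this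

theorem exists_isTopologicalBasis_mk_eq_weight (X : Type*) [TopologicalSpace X] :
    ∃ ℬ : Set (Set X), TopologicalSpace.IsTopologicalBasis ℬ ∧ Cardinal.mk ℬ = weight X :=
  csInf_mem (s := {κ | ∃ B : Set (Set X), TopologicalSpace.IsTopologicalBasis B ∧
    Cardinal.mk B = κ}) ⟨_, _, TopologicalSpace.isTopologicalBasis_opens, rfl⟩

/-- Cosets are disjoint nonempty open sets, so basic sets chosen inside them are distinct. -/
theorem Subgroup.mk_quotient_le_of_isOpen [ContinuousMul G] {ℬ : Set (Set G)}
    (hℬ : TopologicalSpace.IsTopologicalBasis ℬ) {H : Subgroup G} (hH : IsOpen (H : Set G)) :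
    Cardinal.mk (G ⧸ H) ≤ Cardinal.mk ℬ := by
  have : ∀ q : G ⧸ H, ∃ B ∈ ℬ, q.out ∈ B ∧ ∀ x ∈ B, (x : G ⧸ H) = q := fun q => by
    have hopen : IsOpen ((fun x => q.out⁻¹ * x) ⁻¹' (H : Set G)) := hH.preimage (by fun_prop)
    obtain ⟨B, hB, hq, hsub⟩ := hℬ.exists_subset_of_mem_open (a := q.out) (by simp) hopen
    refine ⟨B, hB, hq, fun x hx => ?_⟩
    rw [← q.out_eq']
    exact (QuotientGroup.eq.2 (hsub hx)).symm
  choose B hB hq hsub using this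
  refine Cardinal.mk_le_of_injective (f := fun q => (⟨B q, hB q⟩ : ℬ)) fun q r h => ?_
  have h : B q = B r := Subtype.ext_iff.1 h
  rw [← hsub r q.out (h ▸ hq q)]
  exact (q.out_eq').symm

/-- Under the Continuum Hypothesis, every `P`-group of weight at most `𝔠` is topologically isomorphic
to a subgroup of `𝓗(ω*)_(δ)`. -/
theorem IsTopologicalPGroup.exists_subgroup
    (CH : Cardinal.aleph 1 = (Cardinal.continuum : Cardinal.{0})) (hG : IsTopologicalPGroup G)
    (hw : weight G ≤ Cardinal.continuum) :
    ∃ S : Subgroup (GDeltaModification (HomeoGroup OmegaStar)), Nonempty (G ≃ₜ* S) := by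
  have := hG.isTopologicalGroup
  obtain ⟨ℬ, hℬ, hcard⟩ := exists_isTopologicalBasis_mk_eq_weight G
  rw [← hcard] at hw
  choose H H_open H_sub using fun B : {B : ℬ // (1 : G) ∈ B.1} =>
    hG.exists_subgroup_subset (hℬ.mem_nhds B.1.2 B.2)
  refine hG.exists_subgroup_of_mulAction (Y := Σ B, G ⧸ H B) CH ?_ ?_ ?_
  · rw [Cardinal.mk_sigma]
    refine (Cardinal.sum_le_sum _ (fun _ => Cardinal.continuum) fun B =>
      (Subgroup.mk_quotient_le_of_isOpen hℬ (H_open B)).trans hw).trans ?_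
    rw [Cardinal.sum_const, Cardinal.lift_id, Cardinal.lift_id]
    exact (mul_le_mul' ((Cardinal.mk_subtype_le _).trans hw) le_rfl).trans (by simp)
  · rintro ⟨B, q⟩
    obtain ⟨a, rfl⟩ := QuotientGroup.mk_surjective q
    -- The stabilizer of the coset of `a` is the conjugate by `a` of the open subgroup.
    have hopen : IsOpen ((fun g => a⁻¹ * (g * a)) ⁻¹' (H B : Set G)) :=
      (H_open B).preimage (by fun_prop)
    refine Filter.mem_of_superset (hopen.mem_nhds (by simp)) fun g hg => ?_
    refine congrArg (Sigma.mk B) ?_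
    exact (QuotientGroup.eq.2 hg).symm
  · intro U hU
    obtain ⟨B, hB, h1, hBU⟩ := hℬ.mem_nhds_iff.1 hU
    refine ⟨⟨⟨⟨B, hB⟩, h1⟩, ((1 : G) : G ⧸ _)⟩, fun g hg => hBU (H_sub ⟨⟨B, hB⟩, h1⟩ ?_)⟩
    have hg : ((g * 1 : G) : G ⧸ H ⟨⟨B, hB⟩, h1⟩) = ((1 : G) : G ⧸ H ⟨⟨B, hB⟩, h1⟩) :=
      eq_of_heq (Sigma.mk.inj_iff.1 hg).2
    have := QuotientGroup.eq.1 hg.symm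
    simpa using this

end PGroup

/-- Under the Continuum Hypothesis, `𝓗(ω*)_(δ)` is universal for the class of all `P`-groups of
weight at most `𝔠`: it belongs to the class, and every member of the class is topologically
isomorphic to a subgroup of it. -/
theorem theorem1p2
    (CH : Cardinal.aleph 1 = (Cardinal.continuum : Cardinal.{0})) :
    (IsTopologicalPGroup (GDeltaModification (HomeoGroup OmegaStar)) ∧
      weight (GDeltaModification (HomeoGroup OmegaStar)) ≤ Cardinal.continuum) ∧
    ∀ (G : Type*) [Group G] [TopologicalSpace G], IsTopologicalPGroup G → weight G ≤ Cardinal.continuum →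
      ∃ S : Subgroup (GDeltaModification (HomeoGroup OmegaStar)), Nonempty (G ≃ₜ* S) :=
  ⟨⟨GDeltaModification.isTopologicalPGroup_homeoGroup,
    GDeltaModification.weight_homeoGroup_le OmegaStar.mk_clopens_le⟩,
    fun _ _ _ hG hw => hG.exists_subgroup CH hw⟩
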